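/- Let $K$ be a field and $A$ an integral domain that is a $K$-algebra. A *degree-like function* on $A$ is a map $\delta : A\setminus\{0\}\to\mathbb Z\cup\{-\infty\}$ (extended by $\delta(0)=-\infty$) such that $\delta(c)=0$ for all $c\in K\setminus\{0\}$; $\delta(f+g)\le\max\{\delta(f),\delta(g)\}$ for all $f,g$, where strict inequality implies $\delta(f)=\delta(g)$; and $\delta(fg)\le\delta(f)+\delta(g)$ for all $f,g$. It is *non-negative* if $\delta(f)\ge 0$ for all $f\ne 0$, and a *semidegree* if $\delta(fg)=\delta(f)+\delta(g)$ for all $f,g\neq 0$. A *subdegree* is a maximum $\delta=\max_{1\le i\le N}\delta_i$ of finitely many semidegrees; this presentation is *minimal* if for every $i$ there is $f\in A\setminus\{0\}$ with $\delta_i(f)>\delta_j(f)$ for all $j\ne i$. Put $A^\delta:=\bigoplus_{d\ge 0}F_d$ with $F_d=\{f\in A:\delta(f)\le d\}$, write $(f)_d$ for the copy of $f\in F_d$ in degree $d$, with multiplication given by $(f)_d(g)_e=(fg)_{d+e}$, and call $\delta$ *finitely generated* if $A^\delta$ is a finitely generated $K$-algebra. A *Krull domain* is a domain $B$ such that $B_{\mathfrak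 p}$ is a discrete valuation ring for every height one prime $\mathfrak p$ and every non-zero principal ideal is a finite intersection of primary ideals of height one. **Proposition.** Let $\delta$ be a non-negative finitely generated subdegree on $A$ with minimal presentation $\delta=\max_{1\le i\le N}\delta_i$. 1. Let $B$ be any Krull domain that is an integral extension of $A^\delta$. Then $B$ has only finitely many height one primes containing $(1)_1$, say $\mathfrak p_1,\dots,\mathfrak p_r$. For each $j$ let $\nu_j$ be the discrete valuation of the discrete valuation ring $B_{\mathfrak p_j}$, let $e_j:=\nu_j((1)_1)$, and define, for $f\in A\setminus\{0\}$, $$\hat\delta_j(f)=\delta(f)-\frac{\nu_j\big((f)_{\delta(f)}\big)}{e_j}\in\mathbb Q .$$ Then for each $i$, $1\le i\le N$, there is $j$, $1\le j\le r$, with $\delta_i(f)=\hat\delta_j(f)$ for all $f\in A\setminus\{0\}$. 2. For every $i$ the semidegree $\delta_i$ is integer-valued on $A\setminus\{0\}$, and $-\delta_i$ is a discrete valuation, i.e. it is the restriction to $A\setminus\{0\}$ of a (possibly trivial) valuation $\operatorname{Frac}(A)\to\mathbb Z\cup\{\infty\}$. -/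

import Mathlib

open Polynomial

/-- A degree-like function on a `K`-algebra `A`: a map `A \ {0} → ℤ ∪ {-∞}` (`⊥` is `-∞`).
Following the correspondence with filtrations (`δ(f) = inf {d : f ∈ F_d}` and `0 ∈ F_d` for all
`d`), it is extended by `δ(0) = -∞`; with this convention the axioms at `0` hold trivially. -/
structure DegreeLike (K A : Type*) [Field K] [CommRing A] [Algebra K A] where
  toFun : A → WithBot ℤ
  map_zero' : toFun 0 = ⊥
  map_const' : ∀ c : K, c ≠ 0 → toFun (algebraMap K A c) = 0
  map_add_le' : ∀ f g : A, toFun (f + g) ≤ max (toFun f) (toFun g)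
  eq_of_add_lt' : ∀ f g : A, toFun (f + g) < max (toFun f) (toFun g) → toFun f = toFun g
  map_mul_le' : ∀ f g : A, toFun (f * g) ≤ toFun f + toFun g

namespace DegreeLike

section

variable {K A : Type*} [Field K] [CommRing A] [Algebra K A]

instance : CoeFun (DegreeLike K A) (fun _ => A → WithBot ℤ) := ⟨DegreeLike.toFun⟩

/-- `δ` is non-negative: `δ(f) ≥ 0` for all `f ≠ 0`. -/
def IsNonneg (δ : DegreeLike K A) : Prop := ∀ f : A, f ≠ 0 → 0 ≤ δ f

/-- A semidegree: `δ(fg) = δ(f) + δ(g)` for all non-zero `f, g`. -/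
def IsSemidegree (δ : DegreeLike K A) : Prop :=
  ∀ f g : A, f ≠ 0 → g ≠ 0 → δ (f * g) = δ f + δ g

/-- `δ = max_{1 ≤ i ≤ N} δ_i` with every `δ_i` a semidegree. -/
structure IsPresentation (δ : DegreeLike K A) {N : ℕ} (δs : Fin N → DegreeLike K A) : Prop where
  semidegree : ∀ i, (δs i).IsSemidegree
  eq_max : ∀ f : A, f ≠ 0 → δ f = Finset.univ.sup (fun i => δs i f)

/-- A subdegree: a maximum of finitely many semidegrees. -/
def IsSubdegree (δ : DegreeLike K A) : Prop :=
  ∃ (N : ℕ) (δs : Fin N → DegreeLike K A), δ.IsPresentation δs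

/-- A minimal presentation: one in which no `δ_i` is redundant. -/
structure IsMinimalPresentation (δ : DegreeLike K A) {N : ℕ} (δs : Fin N → DegreeLike K A) :
    Prop extends δ.IsPresentation δs where
  not_redundant : ∀ i, ∃ f : A, f ≠ 0 ∧ ∀ j, j ≠ i → δs j f < δs i f

theorem map_sum_le (δ : DegreeLike K A) {ι : Type*} (s : Finset ι) (F : ι → A) (b : WithBot ℤ)
    (h : ∀ i ∈ s, δ (F i) ≤ b) : δ (∑ i ∈ s, F i) ≤ b := by
  classical
  induction s using Finset.induction_on with
  | empty => simp [δ.map_zero']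
  | insert a s ha ih =>
    rw [Finset.sum_insert ha]
    exact (δ.map_add_le' _ _).trans
      (max_le (h a (by simp)) (ih fun i hi => h i (Finset.mem_insert_of_mem hi)))

theorem map_const_le (δ : DegreeLike K A) (c : K) : δ (algebraMap K A c) ≤ 0 := by
  by_cases hc : c = 0
  · subst hc
    simp [δ.map_zero']
  · exact (δ.map_const' c hc).le

/-- The graded ring `A^δ = ⨁_{d ≥ 0} F_d`, `F_d = {f : δ(f) ≤ d}`, realized as the subalgebra
`∑_{d ≥ 0} F_d t^d` of `A[t]`. -/
def gradedRing (δ : DegreeLike K A) : Subalgebra K A[X] where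
  carrier := {P | ∀ d : ℕ, δ (P.coeff d) ≤ ((d : ℤ) : WithBot ℤ)}
  mul_mem' := by
    intro P Q hP hQ d
    rw [coeff_mul]
    refine δ.map_sum_le _ _ _ fun x hx => ?_
    refine (δ.map_mul_le' _ _).trans ((add_le_add (hP x.1) (hQ x.2)).trans ?_)
    rw [← Finset.HasAntidiagonal.mem_antidiagonal.mp hx]
    push_cast
    exact le_rfl
  add_mem' := by
    intro P Q hP hQ d
    rw [coeff_add]
    exact (δ.map_add_le' _ _).trans (max_le (hP d) (hQ d))
  algebraMap_mem' := by
    intro c d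
    rw [Polynomial.algebraMap_apply, coeff_C]
    split_ifs with hd
    · subst hd
      exact δ.map_const_le c
    · simp [δ.map_zero']

/-- `δ` is finitely generated: `A^δ` is a finitely generated `K`-algebra. -/
def IsFinitelyGenerated (δ : DegreeLike K A) : Prop := Algebra.FiniteType K δ.gradedRing

/-- The copy `(f)_d` of `f ∈ F_d` in the `d`-th graded component of `A^δ`. -/
noncomputable def copy (δ : DegreeLike K A) (f : A) (d : ℕ) (h : δ f ≤ ((d : ℤ) : WithBot ℤ)) :
    δ.gradedRing :=
  ⟨monomial d f, by
    intro e
    rw [coeff_monomial]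
    split_ifs with hd
    · subst hd
      exact h
    · simp [δ.map_zero']⟩

/-- The element `(1)_1` of `A^δ`. -/
noncomputable def oneOne (δ : DegreeLike K A) : δ.gradedRing :=
  δ.copy 1 1 (by
    rw [← _root_.map_one (algebraMap K A)]
    exact (δ.map_const_le 1).trans (by decide))

/-- `δ(f)` as a natural number; for non-negative `δ` and `f ≠ 0` this is the value of `δ` at `f`,
see `coe_natDeg`. -/
noncomputable def natDeg (δ : DegreeLike K A) (f : A) : ℕ := ((δ f).unbotD 0).toNat

theorem le_natDeg (δ : DegreeLike K A) (f : A) : δ f ≤ ((δ.natDeg f : ℤ) : WithBot ℤ) := by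
  unfold natDeg
  cases h : δ f with
  | bot => exact bot_le
  | coe d => exact WithBot.coe_le_coe.mpr (Int.self_le_toNat d)

theorem coe_natDeg (δ : DegreeLike K A) (hδ : δ.IsNonneg) (f : A) (hf : f ≠ 0) :
    ((δ.natDeg f : ℤ) : WithBot ℤ) = δ f := by
  have h0 := hδ f hf
  unfold natDeg
  cases h : δ f with
  | bot => rw [h] at h0; simp at h0
  | coe d =>
    rw [h] at h0
    have : (0 : ℤ) ≤ d := WithBot.coe_le_coe.mp h0
    exact congrArg _ (Int.toNat_of_nonneg this)

/-- The element `(f)_{δ(f)}` of `A^δ`. -/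
noncomputable def lead (δ : DegreeLike K A) (f : A) : δ.gradedRing :=
  δ.copy f (δ.natDeg f) (δ.le_natDeg f)

end

end DegreeLike

/-- A Krull domain: the localizations at height one primes are discrete valuation rings, and every
non-zero principal ideal is a finite intersection of primary ideals of height one (the unit ideal
is the empty intersection). -/
structure IsKrullDomain (B : Type*) [CommRing B] [IsDomain B] : Prop where
  dvr : ∀ (p : Ideal B) [p.IsPrime], p.height = 1 →
    IsDiscreteValuationRing (Localization.AtPrime p)
  primary : ∀ b : B, b ≠ 0 → ∃ S : Finset (Ideal B),
    (∀ q ∈ S, q.IsPrimary ∧ q.height = 1) ∧ Ideal.span {b} = S.inf id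

namespace IsKrullDomain

section

variable {B : Type*} [CommRing B] [IsDomain B]

/-- The discrete valuation of the discrete valuation ring `B_p`, restricted to `B`, for a height one
prime `p` of the Krull domain `B` (with `ν(0) = ⊤`). -/
noncomputable def val (hB : IsKrullDomain B) (p : Ideal B) [p.IsPrime] (hp : p.height = 1) :
    AddValuation B ℕ∞ :=
  haveI := hB.dvr p hp
  (IsDiscreteValuationRing.addVal (Localization.AtPrime p)).comap
    (algebraMap B (Localization.AtPrime p))

theorem val_eq_top_iff (hB : IsKrullDomain B) (p : Ideal B) [p.IsPrime] (hp : p.height = 1)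
    (b : B) : hB.val p hp b = ⊤ ↔ b = 0 := by
  have := hB.dvr p hp
  change IsDiscreteValuationRing.addVal (Localization.AtPrime p) (algebraMap B _ b) = ⊤ ↔ _
  rw [IsDiscreteValuationRing.addVal_eq_top_iff]
  exact map_eq_zero_iff _
    (IsLocalization.injective (Localization.AtPrime p) p.primeCompl_le_nonZeroDivisors)

end

end IsKrullDomain

namespace DegreeLike

section

variable {K A : Type*} [Field K] [CommRing A] [Algebra K A]

/-- For a height one prime `p` of the Krull domain `B ⊇ A^δ` with discrete valuation `ν`, and
`e = ν((1)_1)`: the function `f ↦ δ(f) - ν((f)_{δ(f)}) / e` on `A \ {0}`, with rational values.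
(For `f ≠ 0` and `δ` non-negative, `δ(f)` and both values of `ν` are finite.) -/
noncomputable def hat (δ : DegreeLike K A) {B : Type*} [CommRing B] [IsDomain B]
    [Algebra δ.gradedRing B] (hB : IsKrullDomain B) (p : Ideal B) [p.IsPrime]
    (hp : p.height = 1) (f : A) : ℚ :=
  (δ.natDeg f : ℚ) -
    ((hB.val p hp (algebraMap δ.gradedRing B (δ.lead f))).toNat : ℚ) /
      ((hB.val p hp (algebraMap δ.gradedRing B δ.oneOne)).toNat : ℚ)

end

end DegreeLike

/-!
A semidegree `δ_i` of a minimal presentation defines a prime `P_i` of `A^δ`, spanned by the `(f)_d`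
with `δ_i(f) < d` (`DegreeLike.belowIdeal`). Since `δ` is the maximum of the `δ_i`, the `P_i`
intersect in the ideal of `(1)_1`, and minimality of the presentation makes them incomparable; so
each `P_i` is minimal over `(1)_1` (`IsMinimalPresentation.belowIdeal_le`). In a Krull domain `B`
integral over `A^δ`, some prime of height one contains `(1)_1` and lies over `P_i`
(`IsMinimalPresentation.exists_height_one_over`).

Everything else rests on an element `h` with `δ_i(h) > δ_j(h)` for all `j ≠ i`. Its leading copy is
outside `P_i`, and multiplication by powers of `h` makes `δ_i` dominate at any `f` with
`δ_i(f) ≠ -∞`: then `δ_i(h^m f) = δ(h^m f)`, and the identity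
`(h)_{δ(h)}^m (f)_{δ(f)} = (1)_1^k (h^m f)_{δ(h^m f)}` with `k = δ(f) - δ_i(f)` computes the
valuation of `(f)_{δ(f)}` (`IsMinimalPresentation.eq_hat`). If instead `δ_i(f) = -∞`, the same
identity holds with `k ≥ m` for every `m`, which contradicts Krull's intersection theorem in the
localization of the Noetherian domain `A^δ` at `P_i` (`IsMinimalPresentation.ne_bot`). A semidegree
with finite values is the negative of a valuation by definition, and extends to the fraction field
(`IsSemidegree.exists_addValuation`).
-/

/-! ### Primes of Krull domains containing a given element -/

namespace IsKrullDomain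

variable {B : Type*} [CommRing B] [IsDomain B]

/-- The primes minimal over `b` are among finitely many primes of height one, namely the radicals
of the primary ideals that intersect in the ideal of `b`. -/
theorem exists_height_one_finset (hB : IsKrullDomain B) {b : B} (hb : b ≠ 0) :
    ∃ T : Finset (Ideal B), (∀ q ∈ T, q.IsPrime ∧ q.height = 1 ∧ b ∈ q) ∧
      ∀ p : Ideal B, p.IsPrime → b ∈ p → ∃ q ∈ T, q ≤ p := by
  classical
  obtain ⟨S, hS, hbS⟩ := hB.primary b hb
  refine ⟨S.image Ideal.radical, fun q hq => ?_, fun p hp hbp => ?_⟩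
  · obtain ⟨a, ha, rfl⟩ := Finset.mem_image.mp hq
    refine ⟨Ideal.isPrime_radical (hS a ha).1, ?_, ?_⟩
    · rw [← (hS a ha).2]
      simp only [Ideal.height, Ideal.radical_minimalPrimes]
    · have hle : Ideal.span {b} ≤ a := hbS ▸ Finset.inf_le (f := id) ha
      exact Ideal.le_radical (hle (Ideal.mem_span_singleton_self b))
  · have hle : S.inf id ≤ p := hbS ▸ (Ideal.span_singleton_le_iff_mem p).mpr hbp
    obtain ⟨a, ha, hap⟩ := hp.inf_le'.mp hle
    exact ⟨a.radical, Finset.mem_image_of_mem _ ha, hp.radical_le_iff.mpr hap⟩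

theorem finite_height_one_primes (hB : IsKrullDomain B) {b : B} (hb : b ≠ 0) :
    {p : Ideal B | p.IsPrime ∧ p.height = 1 ∧ b ∈ p}.Finite := by
  obtain ⟨T, hT, hTp⟩ := hB.exists_height_one_finset hb
  refine T.finite_toSet.subset ?_
  rintro p ⟨hp, hp1, hbp⟩
  obtain ⟨q, hq, hqp⟩ := hTp p hp hbp
  obtain ⟨hq', hq1, -⟩ := hT q hq
  rcases hqp.eq_or_lt with rfl | hlt
  · exact hq
  · have : p.FiniteHeight := ⟨Or.inr (by simp [hp1])⟩
    have := Ideal.height_strict_mono_of_isPrime_of_isPrime hlt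
    simp [hp1, hq1] at this

theorem val_eq_zero_iff (hB : IsKrullDomain B) (p : Ideal B) [p.IsPrime] (hp : p.height = 1)
    (b : B) : hB.val p hp b = 0 ↔ b ∉ p := by
  have := hB.dvr p hp
  change IsDiscreteValuationRing.addVal (Localization.AtPrime p) (algebraMap B _ b) = 0 ↔ _
  rw [← nonpos_iff_eq_zero, ← (IsDiscreteValuationRing.addVal (Localization.AtPrime p)).map_one,
    IsDiscreteValuationRing.addVal_le_iff_dvd, ← isUnit_iff_dvd_one,
    IsLocalization.AtPrime.isUnit_to_map_iff (Localization.AtPrime p) p, Ideal.mem_primeCompl_iff]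

end IsKrullDomain

/-! ### Krull's intersection theorem at a prime -/

/-- In the localization at `p`, where `s` is a unit, `x` lies in every power of the maximal
ideal. -/
theorem eq_zero_of_forall_pow_dvd_pow_mul {R : Type*} [CommRing R] [IsDomain R]
    [IsNoetherianRing R] {p : Ideal R} [p.IsPrime] {s t x : R} (ht : t ∈ p) (hs : s ∉ p)
    (h : ∀ m : ℕ, t ^ m ∣ s ^ m * x) : x = 0 := by
  let L := Localization.AtPrime p
  have : IsNoetherianRing L := IsLocalization.isNoetherianRing p.primeCompl L inferInstance
  have hsu : IsUnit (algebraMap R L s) := (IsLocalization.AtPrime.isUnit_to_map_iff L p s).mpr hs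
  have hinf := Ideal.iInf_pow_eq_bot_of_isLocalRing (IsLocalRing.maximalIdeal L)
    (IsLocalRing.maximalIdeal.isMaximal L).ne_top
  have hx : algebraMap R L x ∈ ⨅ m : ℕ, IsLocalRing.maximalIdeal L ^ m := by
    refine (Ideal.mem_iInf).mpr fun m => ?_
    obtain ⟨y, hy⟩ := (hsu.pow m).dvd_mul_left.mp
      (by simpa only [map_mul, map_pow] using map_dvd (algebraMap R L) (h m))
    rw [hy]
    exact Ideal.mul_mem_right _ _ (Ideal.pow_mem_pow
      ((IsLocalization.AtPrime.to_map_mem_maximal_iff L p t).mpr ht) m)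
  rw [hinf, Ideal.mem_bot] at hx
  exact (map_eq_zero_iff _ (IsLocalization.injective L p.primeCompl_le_nonZeroDivisors)).mp hx

/-! ### Degree-like functions -/

namespace DegreeLike

variable {K A : Type*} [Field K] [CommRing A] [Algebra K A]

theorem map_one (δ : DegreeLike K A) : δ 1 = 0 := by
  simpa using δ.map_const' 1 one_ne_zero

theorem map_add_eq_left (δ : DegreeLike K A) {f g : A} (h : δ g < δ f) : δ (f + g) = δ f := by
  refine ((δ.map_add_le' f g).trans_eq (max_eq_left h.le)).antisymm (not_lt.mp fun hlt => ?_)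
  exact h.ne' (δ.eq_of_add_lt' f g (hlt.trans_le (le_max_left _ _)))

theorem map_pow_mul_le (δ : DegreeLike K A) {f h : A} {a b : ℤ} (hh : δ h ≤ a) (hf : δ f ≤ b)
    (m : ℕ) : δ (h ^ m * f) ≤ ((m * a + b : ℤ) : WithBot ℤ) := by
  induction m with
  | zero => simpa using hf
  | succ m ih =>
    rw [pow_succ', mul_assoc]
    refine (δ.map_mul_le' _ _).trans ((add_le_add hh ih).trans_eq ?_)
    rw [← WithBot.coe_add]
    congr 1
    push_cast
    ring

theorem IsSemidegree.map_mul {ε : DegreeLike K A} (hε : ε.IsSemidegree) (f g : A) :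
    ε (f * g) = ε f + ε g := by
  by_cases hf : f = 0
  · simp [hf, ε.map_zero']
  by_cases hg : g = 0
  · simp [hg, ε.map_zero']
  exact hε f g hf hg

theorem IsSemidegree.map_pow_mul {ε : DegreeLike K A} (hε : ε.IsSemidegree) {f h : A} {a b : ℤ}
    (hh : ε h = a) (hf : ε f = b) (m : ℕ) :
    ε (h ^ m * f) = ((m * a + b : ℤ) : WithBot ℤ) := by
  induction m with
  | zero => simpa using hf
  | succ m ih =>
    rw [pow_succ', mul_assoc, hε.map_mul, ih, hh, ← WithBot.coe_add]
    congr 1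
    push_cast
    ring

/-- The negative of a semidegree with finite values extends to a valuation of the fraction field;
the axioms of a semidegree are those of a valuation with the order reversed. -/
theorem IsSemidegree.exists_addValuation [IsDomain A] {ε : DegreeLike K A}
    (hε : ε.IsSemidegree) (hbot : ∀ f : A, f ≠ 0 → ε f ≠ ⊥) :
    ∃ v : AddValuation (FractionRing A) (WithTop ℤ), ∀ (f : A) (m : ℤ), ε f = (m : WithBot ℤ) →
      v (algebraMap A (FractionRing A) f) = ((-m : ℤ) : WithTop ℤ) := by
  -- `-∞ ↦ ⊤` and `n ↦ -n`, an order-reversing additive map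
  let φ : WithBot ℤ → WithTop ℤ := WithBot.recBotCoe ⊤ fun n => ((-n : ℤ) : WithTop ℤ)
  have hφ_bot : φ ⊥ = ⊤ := rfl
  have hφ_coe : ∀ n : ℤ, φ n = ((-n : ℤ) : WithTop ℤ) := fun _ => rfl
  have hφ_add : ∀ x y, φ (x + y) = φ x + φ y := fun x y => by
    induction x using WithBot.recBotCoe with
    | bot => simp [hφ_bot]
    | coe a =>
      induction y using WithBot.recBotCoe with
      | bot => simp [hφ_bot]
      | coe b => rw [← WithBot.coe_add, hφ_coe, hφ_coe, hφ_coe, neg_add, WithTop.coe_add]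
  have hφ_anti : Antitone φ := fun x y hxy => by
    induction x using WithBot.recBotCoe with
    | bot => simp [hφ_bot]
    | coe a =>
      induction y using WithBot.recBotCoe with
      | bot => simp at hxy
      | coe b =>
        rw [hφ_coe, hφ_coe]
        exact WithTop.coe_le_coe.mpr (neg_le_neg (WithBot.coe_le_coe.mp hxy))
  let w : AddValuation A (WithTop ℤ) := AddValuation.of (fun f => φ (ε f))
    (by rw [ε.map_zero', hφ_bot]) (by rw [ε.map_one]; rfl)
    (fun f g => (hφ_anti.map_max).symm.le.trans (hφ_anti (ε.map_add_le' f g)))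
    (fun f g => by rw [hε.map_mul, hφ_add])
  have hw : ∀ f, w f = φ (ε f) := fun _ => rfl
  let V : Valuation A (Multiplicative (WithTop ℤ)ᵒᵈ) := AddValuation.toValuation w
  have hV : nonZeroDivisors A ≤ V.supp.primeCompl := fun f hf hf0 => by
    have htop : φ (ε f) = ⊤ := (V.mem_supp_iff f).mp hf0
    obtain ⟨n, hn⟩ := WithBot.ne_bot_iff_exists.mp (hbot f (nonZeroDivisors.ne_zero hf))
    rw [← hn, hφ_coe] at htop
    exact WithTop.coe_ne_top htop
  refine ⟨AddValuation.ofValuation (V.extendToLocalization hV (FractionRing A)),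
    fun f m hm => ?_⟩
  rw [AddValuation.ofValuation_apply, Valuation.extendToLocalization_apply_map_apply]
  change φ (ε f) = _
  rw [hm, hφ_coe]

/-! ### The prime of the graded ring attached to a semidegree -/

/-- For a semidegree `ε ≤ δ`, the prime ideal of `A^δ` spanned by the `(f)_d` with `ε(f) < d`. -/
def belowIdeal (δ ε : DegreeLike K A) (hle : ∀ f, ε f ≤ δ f) : Ideal δ.gradedRing where
  carrier := {P | ∀ d : ℕ, ε ((P : A[X]).coeff d) < ((d : ℤ) : WithBot ℤ)}
  zero_mem' d := by simp [ε.map_zero']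
  add_mem' {P Q} hP hQ d := by
    rw [Subalgebra.coe_add, coeff_add]
    exact (ε.map_add_le' _ _).trans_lt (max_lt (hP d) (hQ d))
  smul_mem' P Q hQ d := by
    have key : ∀ x ∈ Finset.HasAntidiagonal.antidiagonal d, ε ((P : A[X]).coeff x.1 * (Q : A[X]).coeff x.2) ≤
        ((d - 1 : ℤ) : WithBot ℤ) := fun x hx => by
      have hQx := hQ x.2
      refine (ε.map_mul_le' _ _).trans ?_
      cases h : ε ((Q : A[X]).coeff x.2) with
      | bot => simp
      | coe b =>
        rw [h] at hQx
        have hb : b < (x.2 : ℤ) := WithBot.coe_lt_coe.mp hQx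
        refine (add_le_add_left ((hle _).trans (P.2 x.1)) _).trans ?_
        rw [← WithBot.coe_add, WithBot.coe_le_coe]
        have := Finset.HasAntidiagonal.mem_antidiagonal.mp hx
        omega
    rw [smul_eq_mul, Subalgebra.coe_mul, coeff_mul]
    exact (ε.map_sum_le _ _ _ key).trans_lt (WithBot.coe_lt_coe.mpr (by omega))

theorem mem_belowIdeal {δ ε : DegreeLike K A} {hle : ∀ f, ε f ≤ δ f} {P : δ.gradedRing} :
    P ∈ δ.belowIdeal ε hle ↔ ∀ d : ℕ, ε ((P : A[X]).coeff d) < ((d : ℤ) : WithBot ℤ) := Iff.rfl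

theorem copy_mem_belowIdeal {δ ε : DegreeLike K A} {hle : ∀ f, ε f ≤ δ f} {f : A} {d : ℕ}
    {hd : δ f ≤ ((d : ℤ) : WithBot ℤ)} :
    δ.copy f d hd ∈ δ.belowIdeal ε hle ↔ ε f < ((d : ℤ) : WithBot ℤ) := by
  refine ⟨fun h => by simpa [copy] using h d, fun h e => ?_⟩
  simp only [copy, coeff_monomial]
  split_ifs with hde
  · exact hde ▸ h
  · simp [ε.map_zero']

theorem oneOne_mem_belowIdeal {δ ε : DegreeLike K A} {hle : ∀ f, ε f ≤ δ f} :
    δ.oneOne ∈ δ.belowIdeal ε hle :=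
  copy_mem_belowIdeal.mpr (by rw [ε.map_one]; decide)

theorem lead_mem_belowIdeal {δ ε : DegreeLike K A} {hle : ∀ f, ε f ≤ δ f} (hδ : δ.IsNonneg)
    {f : A} (hf : f ≠ 0) : δ.lead f ∈ δ.belowIdeal ε hle ↔ ε f < δ f := by
  rw [lead, copy_mem_belowIdeal, δ.coe_natDeg hδ f hf]

/-- The product of two elements outside `belowIdeal` is outside it: the top degrees in which they
violate the defining inequality add up. -/
theorem IsSemidegree.isPrime_belowIdeal {δ ε : DegreeLike K A} (hε : ε.IsSemidegree)
    (hle : ∀ f, ε f ≤ δ f) : (δ.belowIdeal ε hle).IsPrime := by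
  classical
  have top : ∀ P : δ.gradedRing, P ∉ δ.belowIdeal ε hle →
      ∃ d : ℕ, ε ((P : A[X]).coeff d) = ((d : ℤ) : WithBot ℤ) ∧
        ∀ e : ℕ, d < e → ε ((P : A[X]).coeff e) < ((e : ℤ) : WithBot ℤ) := fun P hP => by
    rw [mem_belowIdeal] at hP
    push Not at hP
    have hbd : ∀ d : ℕ, ((d : ℤ) : WithBot ℤ) ≤ ε ((P : A[X]).coeff d) →
        d ≤ (P : A[X]).natDegree := fun d hd => by
      by_contra hlt
      rw [coeff_eq_zero_of_natDegree_lt (not_le.mp hlt), ε.map_zero'] at hd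
      simp at hd
    obtain ⟨d₀, hd₀⟩ := hP
    have hspec := Nat.findGreatest_spec
      (P := fun d => ((d : ℤ) : WithBot ℤ) ≤ ε ((P : A[X]).coeff d)) (hbd d₀ hd₀) hd₀
    refine ⟨_, ((hle _).trans (P.2 _)).antisymm hspec, fun e he => ?_⟩
    by_contra hcon
    exact he.not_ge (Nat.le_findGreatest (hbd e (not_lt.mp hcon)) (not_lt.mp hcon))
  refine ⟨fun h => ?_, fun {P Q} hPQ => ?_⟩
  · have h1 := mem_belowIdeal.mp ((Ideal.eq_top_iff_one _).mp h) 0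
    simp [ε.map_one] at h1
  · by_contra! hcon
    obtain ⟨a, ha, haP⟩ := top P hcon.1
    obtain ⟨b, hb, hbQ⟩ := top Q hcon.2
    have hmem : (a, b) ∈ Finset.HasAntidiagonal.antidiagonal (a + b) := by simp
    have hlead : ε ((P : A[X]).coeff a * (Q : A[X]).coeff b) =
        (((a + b : ℕ) : ℤ) : WithBot ℤ) := by
      rw [hε.map_mul, ha, hb, ← WithBot.coe_add, Nat.cast_add]
    have hrest : ε (∑ x ∈ (Finset.HasAntidiagonal.antidiagonal (a + b)).erase (a, b),
        (P : A[X]).coeff x.1 * (Q : A[X]).coeff x.2) ≤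
          (((a + b : ℕ) - 1 : ℤ) : WithBot ℤ) := by
      refine ε.map_sum_le _ _ _ fun x hx => ?_
      obtain ⟨hne, hx⟩ := Finset.mem_erase.mp hx
      rw [Finset.HasAntidiagonal.mem_antidiagonal] at hx
      have hP := (hle _).trans (P.2 x.1)
      have hQ := (hle _).trans (Q.2 x.2)
      have hlt : ε ((P : A[X]).coeff x.1) < ((x.1 : ℤ) : WithBot ℤ) ∨
          ε ((Q : A[X]).coeff x.2) < ((x.2 : ℤ) : WithBot ℤ) := by
        rcases lt_trichotomy x.1 a with h | h | h
        · exact Or.inr (hbQ _ (by omega))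
        · exact absurd (Prod.ext h (by simp only; omega)) hne
        · exact Or.inl (haP _ h)
      rw [hε.map_mul]
      cases hp : ε ((P : A[X]).coeff x.1) with
      | bot => simp
      | coe p =>
        cases hq : ε ((Q : A[X]).coeff x.2) with
        | bot => simp
        | coe q =>
          rw [hp] at hP hlt
          rw [hq] at hQ hlt
          rw [WithBot.coe_le_coe] at hP hQ
          rw [WithBot.coe_lt_coe, WithBot.coe_lt_coe] at hlt
          rw [← WithBot.coe_add, WithBot.coe_le_coe]
          omega
    have hsum := mem_belowIdeal.mp hPQ (a + b)
    rw [Subalgebra.coe_mul, coeff_mul, ← Finset.add_sum_erase _ _ hmem,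
      ε.map_add_eq_left (hrest.trans_lt ?_), hlead] at hsum
    · exact lt_irrefl _ hsum
    · rw [hlead]
      exact WithBot.coe_lt_coe.mpr (by omega)

/-! ### Divisibility by `(1)_1` in the graded ring -/

theorem oneOne_ne_zero [Nontrivial A] (δ : DegreeLike K A) : δ.oneOne ≠ 0 := fun h => by
  have h1 : monomial 1 (1 : A) = 0 := congrArg Subtype.val h
  simp at h1

/-- `δ(f) < d` for every component `(f)_d` of `P` makes `P` divisible by `(1)_1`. -/
theorem oneOne_dvd {δ : DegreeLike K A} (hδ : δ.IsNonneg) {P : δ.gradedRing}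
    (hP : ∀ d : ℕ, δ ((P : A[X]).coeff d) < ((d : ℤ) : WithBot ℤ)) : δ.oneOne ∣ P := by
  have h0 : (P : A[X]).coeff 0 = 0 := by
    by_contra h
    exact (hδ _ h).not_gt (by simpa using hP 0)
  refine ⟨⟨(P : A[X]).divX, fun d => ?_⟩, Subtype.ext ?_⟩
  · rw [coeff_divX]
    have h := hP (d + 1)
    cases hc : δ ((P : A[X]).coeff (d + 1)) with
    | bot => exact bot_le
    | coe n =>
      rw [hc, WithBot.coe_lt_coe] at h
      exact WithBot.coe_le_coe.mpr (by omega)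
  · have h := X_mul_divX_add (P : A[X])
    rw [h0, C_0, add_zero] at h
    exact h.symm

/-- Both sides are the copy of `h ^ m * f` in the same degree. -/
theorem lead_pow_mul_lead (δ : DegreeLike K A) {f h : A} {m k : ℕ}
    (hk : k + δ.natDeg (h ^ m * f) = m * δ.natDeg h + δ.natDeg f) :
    δ.lead h ^ m * δ.lead f = δ.oneOne ^ k * δ.lead (h ^ m * f) := by
  refine Subtype.ext ?_
  change monomial (δ.natDeg h) h ^ m * monomial (δ.natDeg f) f =
    monomial 1 1 ^ k * monomial (δ.natDeg (h ^ m * f)) (h ^ m * f)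
  rw [monomial_pow, monomial_pow, monomial_mul_monomial, monomial_mul_monomial, one_pow, one_mul,
    one_mul, hk, mul_comm m]

/-! ### Minimal presentations -/

section

variable {δ : DegreeLike K A} {N : ℕ} {δs : Fin N → DegreeLike K A}

theorem IsPresentation.le (hp : δ.IsPresentation δs) (i : Fin N) (f : A) : δs i f ≤ δ f := by
  by_cases hf : f = 0
  · simp [hf, (δs i).map_zero']
  · rw [hp.eq_max f hf]
    exact Finset.le_sup (f := fun i => δs i f) (Finset.mem_univ i)

theorem IsPresentation.eq_of_forall_le (hp : δ.IsPresentation δs) {i : Fin N} {f : A}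
    (h : ∀ j, j ≠ i → δs j f ≤ δs i f) : δs i f = δ f := by
  by_cases hf : f = 0
  · simp [hf, (δs i).map_zero', δ.map_zero']
  · refine (hp.le i f).antisymm ?_
    rw [hp.eq_max f hf]
    refine Finset.sup_le fun j _ => ?_
    by_cases hj : j = i
    · rw [hj]
    · exact h j hj

/-- An element on which `δ_i` is strictly the largest: its degree `δ_i(h) = δ(h)` exceeds every
other `δ_j(h)` by at least one. -/
theorem IsMinimalPresentation.exists_dominant (hmin : δ.IsMinimalPresentation δs)
    (hδ : δ.IsNonneg) (i : Fin N) :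
    ∃ h : A, h ≠ 0 ∧ δs i h = ((δ.natDeg h : ℤ) : WithBot ℤ) ∧
      ∀ j, j ≠ i → δs j h ≤ ((δ.natDeg h - 1 : ℤ) : WithBot ℤ) := by
  obtain ⟨h, h0, hlt⟩ := hmin.not_redundant i
  have hi : δs i h = ((δ.natDeg h : ℤ) : WithBot ℤ) := by
    rw [hmin.eq_of_forall_le fun j hj => (hlt j hj).le, δ.coe_natDeg hδ h h0]
  refine ⟨h, h0, hi, fun j hj => ?_⟩
  have hj' := hlt j hj
  rw [hi] at hj'
  cases hc : δs j h with
  | bot => exact bot_le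
  | coe n =>
    rw [hc, WithBot.coe_lt_coe] at hj'
    exact WithBot.coe_le_coe.mpr (by omega)

/-- The `belowIdeal`s of the `δ_i` intersect in the ideal of `(1)_1` and are pairwise
incomparable, so each of them is minimal over that ideal. -/
theorem IsMinimalPresentation.belowIdeal_le (hmin : δ.IsMinimalPresentation δs)
    (hδ : δ.IsNonneg) (i : Fin N) {Q : Ideal δ.gradedRing} (hQ : Q.IsPrime)
    (htQ : δ.oneOne ∈ Q) (hQi : Q ≤ δ.belowIdeal (δs i) (hmin.le i)) :
    δ.belowIdeal (δs i) (hmin.le i) ≤ Q := by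
  have hinf : Finset.univ.inf (fun j => δ.belowIdeal (δs j) (hmin.le j)) ≤ Q := fun P hP => by
    refine Ideal.mem_of_dvd _ (oneOne_dvd hδ fun d => ?_) htQ
    by_cases hd : (P : A[X]).coeff d = 0
    · simp [hd, δ.map_zero']
    · rw [hmin.eq_max _ hd, Finset.sup_lt_iff (WithBot.bot_lt_coe _)]
      exact fun j hj => mem_belowIdeal.mp (Finset.inf_le (f := fun j =>
        δ.belowIdeal (δs j) (hmin.le j)) hj hP) d
  obtain ⟨j, -, hjQ⟩ := hQ.inf_le'.mp hinf
  by_cases hj : j = i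
  · exact hj ▸ hjQ
  · obtain ⟨h, h0, hi, hlt⟩ := hmin.exists_dominant hδ i
    have hmem : δ.lead h ∈ δ.belowIdeal (δs i) (hmin.le i) := by
      refine hQi (hjQ ((lead_mem_belowIdeal hδ h0).mpr ?_))
      rw [← δ.coe_natDeg hδ h h0]
      exact (hlt j hj).trans_lt (WithBot.coe_lt_coe.mpr (by omega))
    rw [lead_mem_belowIdeal hδ h0, hi, δ.coe_natDeg hδ h h0] at hmem
    exact absurd hmem (lt_irrefl _)

/-- If `δ_i(f) = -∞` and `h` is dominant for `δ_i`, then `δ(h^m f)` falls short of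
`m δ(h) + δ(f)` by at least `m`, so `(f)_{δ(f)}` is divisible by every power of `(1)_1` up to
factors outside the prime of `δ_i`; Krull's intersection theorem excludes this. -/
theorem IsMinimalPresentation.ne_bot [IsDomain A] (hmin : δ.IsMinimalPresentation δs)
    (hδ : δ.IsNonneg) (hfg : δ.IsFinitelyGenerated) (i : Fin N) {f : A} (hf : f ≠ 0) :
    δs i f ≠ ⊥ := fun hbot => by
  have : Algebra.FiniteType K δ.gradedRing := hfg
  have : IsNoetherianRing δ.gradedRing := Algebra.FiniteType.isNoetherianRing K _
  have hprime := (hmin.semidegree i).isPrime_belowIdeal (hmin.le i)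
  obtain ⟨h, h0, hi, hlt⟩ := hmin.exists_dominant hδ i
  have hh : δ.lead h ∉ δ.belowIdeal (δs i) (hmin.le i) := by
    rw [lead_mem_belowIdeal hδ h0, hi, δ.coe_natDeg hδ h h0]
    exact lt_irrefl _
  have hzero : δ.lead f = 0 := by
    refine eq_zero_of_forall_pow_dvd_pow_mul (oneOne_mem_belowIdeal (hle := hmin.le i)) hh
      fun m => ?_
    have hg : h ^ m * f ≠ 0 := mul_ne_zero (pow_ne_zero m h0) hf
    have hbound : δ (h ^ m * f) ≤
        ((m * (δ.natDeg h - 1) + δ.natDeg f : ℤ) : WithBot ℤ) := by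
      rw [hmin.eq_max _ hg]
      refine Finset.sup_le fun j _ => ?_
      by_cases hj : j = i
      · rw [hj, (hmin.semidegree i).map_mul, hbot, WithBot.add_bot]
        exact bot_le
      · exact (δs j).map_pow_mul_le (hlt j hj) ((hmin.le j f).trans (δ.le_natDeg f)) m
    rw [← δ.coe_natDeg hδ _ hg, WithBot.coe_le_coe, mul_sub, mul_one] at hbound
    have hle : δ.natDeg (h ^ m * f) + m ≤ m * δ.natDeg h + δ.natDeg f := by
      zify
      linarith
    rw [δ.lead_pow_mul_lead
      (k := m * δ.natDeg h + δ.natDeg f - δ.natDeg (h ^ m * f)) (by omega)]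
    exact Dvd.dvd.mul_right (pow_dvd_pow _ (by omega)) _
  have hmono : monomial (δ.natDeg f) f = 0 := congrArg Subtype.val hzero
  exact hf ((monomial_eq_zero_iff _ _).mp hmono)

/-- If the height one prime `p` lies over the prime of `δ_i`, then the leading copy of `g` is a
unit at `p` whenever `δ_i(g) = δ(g)`. A high power of a dominant element `h` makes this hold for
`g = h^m f`, which determines the value of the valuation at `(f)_{δ(f)}`. -/
theorem IsMinimalPresentation.eq_hat [IsDomain A] (hmin : δ.IsMinimalPresentation δs)
    (hδ : δ.IsNonneg) (i : Fin N) {B : Type*} [CommRing B] [IsDomain B]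
    [Algebra δ.gradedRing B] [FaithfulSMul δ.gradedRing B] (hB : IsKrullDomain B) (p : Ideal B)
    [p.IsPrime] (hp : p.height = 1)
    (hpi : p.comap (algebraMap δ.gradedRing B) = δ.belowIdeal (δs i) (hmin.le i))
    {f : A} (hf : f ≠ 0) {k : ℤ} (hk : δs i f = k) : (k : ℚ) = δ.hat hB p hp f := by
  obtain ⟨h, h0, hi, hlt⟩ := hmin.exists_dominant hδ i
  have hunit : ∀ g : A, g ≠ 0 → δs i g = δ g →
      hB.val p hp (algebraMap δ.gradedRing B (δ.lead g)) = 0 := fun g hg hgi => by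
    rw [hB.val_eq_zero_iff, ← Ideal.mem_comap, hpi, lead_mem_belowIdeal hδ hg, hgi]
    exact lt_irrefl _
  have hkf : k ≤ δ.natDeg f :=
    WithBot.coe_le_coe.mp (hk ▸ (hmin.le i f).trans (δ.le_natDeg f))
  obtain ⟨m, hm⟩ := Int.eq_ofNat_of_zero_le (sub_nonneg.mpr hkf)
  -- `m = δ(f) - δ_i(f)` is large enough for `δ_i` to attain the maximum at `h ^ m * f`
  have hg0 : h ^ m * f ≠ 0 := mul_ne_zero (pow_ne_zero m h0) hf
  have hgi := (hmin.semidegree i).map_pow_mul hi hk m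
  have hg : δs i (h ^ m * f) = δ (h ^ m * f) := hmin.eq_of_forall_le fun j hj => by
    rw [hgi]
    refine ((δs j).map_pow_mul_le (hlt j hj) ((hmin.le j f).trans (δ.le_natDeg f)) m).trans ?_
    rw [WithBot.coe_le_coe, mul_sub]
    linarith
  have hdeg : m + δ.natDeg (h ^ m * f) = m * δ.natDeg h + δ.natDeg f := by
    have h1 := (δ.coe_natDeg hδ _ hg0).trans (hg.symm.trans hgi)
    rw [WithBot.coe_inj] at h1
    zify
    linarith
  have hval := congrArg (fun x => hB.val p hp (algebraMap δ.gradedRing B x))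
    (δ.lead_pow_mul_lead hdeg)
  simp only [map_mul, map_pow, AddValuation.map_mul, AddValuation.map_pow] at hval
  rw [hunit h h0 (by rw [hi, δ.coe_natDeg hδ h h0]), hunit _ hg0 hg, smul_zero, zero_add,
    add_zero] at hval
  have ht_ne_top : hB.val p hp (algebraMap δ.gradedRing B δ.oneOne) ≠ ⊤ := by
    rw [Ne, hB.val_eq_top_iff, map_eq_zero_iff _ (FaithfulSMul.algebraMap_injective _ _)]
    exact δ.oneOne_ne_zero
  have ht_ne_zero : hB.val p hp (algebraMap δ.gradedRing B δ.oneOne) ≠ 0 := by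
    rw [Ne, hB.val_eq_zero_iff, not_not, ← Ideal.mem_comap, hpi]
    exact oneOne_mem_belowIdeal
  have ht : ((hB.val p hp (algebraMap δ.gradedRing B δ.oneOne)).toNat : ℚ) ≠ 0 := by
    rw [Nat.cast_ne_zero, Ne, ENat.toNat_eq_zero]
    tauto
  rw [hat, hval, nsmul_eq_mul, ENat.toNat_mul, ENat.toNat_natCast, Nat.cast_mul,
    mul_div_cancel_right₀ _ ht]
  have hmq : (δ.natDeg f : ℚ) - k = m := by exact_mod_cast hm
  linarith

/-- Lying over gives a prime of `B` over the prime of `δ_i`. A height one prime below it that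
contains `(1)_1` contracts to the same prime, which is minimal over `(1)_1`; so going down is not
needed. -/
theorem IsMinimalPresentation.exists_height_one_over [IsDomain A]
    (hmin : δ.IsMinimalPresentation δs) (hδ : δ.IsNonneg) (i : Fin N) {B : Type*} [CommRing B]
    [IsDomain B] [Algebra δ.gradedRing B] [FaithfulSMul δ.gradedRing B]
    [Algebra.IsIntegral δ.gradedRing B] (hB : IsKrullDomain B) :
    ∃ p : Ideal B, p.IsPrime ∧ p.height = 1 ∧
      p.comap (algebraMap δ.gradedRing B) = δ.belowIdeal (δs i) (hmin.le i) := by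
  have hinj := FaithfulSMul.algebraMap_injective δ.gradedRing B
  have hprime := (hmin.semidegree i).isPrime_belowIdeal (hmin.le i)
  obtain ⟨Q, hQ, hQi⟩ := Ideal.exists_ideal_over_prime_of_isIntegral_of_isDomain (S := B)
    (δ.belowIdeal (δs i) (hmin.le i))
    (by rw [(RingHom.injective_iff_ker_eq_bot _).mp hinj]; exact bot_le)
  obtain ⟨T, hT, hTQ⟩ := hB.exists_height_one_finset
    ((map_ne_zero_iff _ hinj).mpr δ.oneOne_ne_zero)
  obtain ⟨p, hpT, hpQ⟩ := hTQ Q hQ (by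
    rw [← Ideal.mem_comap, hQi]
    exact oneOne_mem_belowIdeal)
  obtain ⟨hp, hp1, htp⟩ := hT p hpT
  have hle : p.comap (algebraMap δ.gradedRing B) ≤ δ.belowIdeal (δs i) (hmin.le i) :=
    hQi ▸ Ideal.comap_mono hpQ
  exact ⟨p, hp, hp1, hle.antisymm
    (hmin.belowIdeal_le hδ i (Ideal.comap_isPrime _ p) htp hle)⟩

end

end DegreeLike

theorem proposition5p2 {K : Type*} {A : Type*} [Field K] [CommRing A] [IsDomain A] [Algebra K A]
    (δ : DegreeLike K A) (hnonneg : δ.IsNonneg) (hsub : δ.IsSubdegree)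
    (hfg : δ.IsFinitelyGenerated)
    {N : ℕ} (δs : Fin N → DegreeLike K A) (hmin : δ.IsMinimalPresentation δs) :
    -- the semidegrees in terms of an arbitrary Krull domain integral over `A^δ`
    (∀ (B : Type*) [CommRing B] [IsDomain B] [Algebra δ.gradedRing B]
        [FaithfulSMul δ.gradedRing B] [Algebra.IsIntegral δ.gradedRing B]
        (hB : IsKrullDomain B),
      {p : Ideal B | p.IsPrime ∧ p.height = 1 ∧
        algebraMap δ.gradedRing B δ.oneOne ∈ p}.Finite ∧
      ∀ i : Fin N, ∃ (p : Ideal B) (_ : p.IsPrime) (hp : p.height = 1),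
        algebraMap δ.gradedRing B δ.oneOne ∈ p ∧
        ∀ f : A, f ≠ 0 → ∃ m : ℤ, δs i f = (m : WithBot ℤ) ∧ (m : ℚ) = δ.hat hB p hp f) ∧
    -- each semidegree is integer-valued and its negative is a discrete valuation
    (∀ i : Fin N, (∀ f : A, f ≠ 0 → ∃ m : ℤ, δs i f = (m : WithBot ℤ)) ∧
      ∃ v : AddValuation (FractionRing A) (WithTop ℤ),
        ∀ (f : A) (m : ℤ), f ≠ 0 → δs i f = (m : WithBot ℤ) →
          v (algebraMap A (FractionRing A) f) = ((-m : ℤ) : WithTop ℤ)) := by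
  have hint : ∀ (i : Fin N) (f : A), f ≠ 0 → ∃ m : ℤ, δs i f = (m : WithBot ℤ) :=
    fun i f hf => (WithBot.ne_bot_iff_exists.mp (hmin.ne_bot hnonneg hfg i hf)).imp
      fun _ => Eq.symm
  refine ⟨fun B _ _ _ _ _ hB => ⟨?_, fun i => ?_⟩, fun i => ⟨hint i, ?_⟩⟩
  · exact hB.finite_height_one_primes ((map_ne_zero_iff _
      (FaithfulSMul.algebraMap_injective δ.gradedRing B)).mpr δ.oneOne_ne_zero)
  · obtain ⟨p, hp, hp1, hpi⟩ := hmin.exists_height_one_over hnonneg i hB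
    refine ⟨p, hp, hp1, ?_, fun f hf => ?_⟩
    · rw [← Ideal.mem_comap, hpi]
      exact DegreeLike.oneOne_mem_belowIdeal
    · obtain ⟨m, hm⟩ := hint i f hf
      exact ⟨m, hm, hmin.eq_hat hnonneg i hB p hp1 hpi hf hm⟩
  · obtain ⟨v, hv⟩ := (hmin.semidegree i).exists_addValuation
      fun f => hmin.ne_bot hnonneg hfg i
    exact ⟨v, fun f m _ => hv f m⟩
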